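/- In the coordinator model there are $s$ players and a coordinator. Player $i$ holds an edge set $E_i$ on the common vertex set $V=\{1,\dots,n\}$, the sets $E_1,\dots,E_s$ are pairwise disjoint (no edge duplication), and $G=(V,\bigcup_i E_i)$ is an unweighted undirected graph. All parties have private random coins; bits are exchanged only over point-to-point links between the coordinator and the individual players, the other players do not see them, and the coordinator must produce the output. A multiplicative $\alpha$-spanner of $G$ is a subgraph $H$ of $G$ with $d_H(u,v)\le \alpha\, d_G(u,v)$ for all $u,v\in V$. **Theorem.** For $k\ge 3$, the communication cost of the multiplicative $(2k-1)$-spanner problem without edge duplication is $\tilde O\bigl(k\,s^{1-2/k}n^{1+1/k}+snk\bigr)$ bits. That is, there is a constant $a$ such that for every $c\in\mathbb N$ there is a constant $C>0$ such that for all integers $k\ge 3$, $n\ge 2$, $s\ge 1$ there is a randomized protocol with the following property: for every choice of pairwise disjoint $E_1,\dots,E_s$, the total number of bits sent is always at most $$C\,(\log_2 n)^{a}\,\bigl(k\,s^{1-2/k}\,n^{1+1/k}+s\,n\,k\bigr),$$ and with probability at least $1-n^{-c}$ the coordinator outputs a multiplicative $(2k-1)$-spanner of $G$. -/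

import Mathlib

/-! ### The coordinator (message-passing) model of communication

There are `s` players, player `i` holding a private input and private random coins, and a
coordinator without input, holding private random coins of its own.  Communication happens only
over the `s` point-to-point links between the coordinator and a single player. -/

/-- One bit on the link between the coordinator and a given player, as seen by that player. -/
inductive LinkEvent where
  /-- the player received the bit `b` from the coordinator -/
  | received (b : Bool)
  /-- the player sent the bit `b` to the coordinator -/
  | sent (b : Bool)

/-- A (deterministic) strategy of the coordinator: a finite decision tree.  At every moment the
coordinator either stops with an output, or sends one bit to one player, or receives one bit from
one player and continues depending on that bit. -/
inductive CoordStrategy (s : ℕ) (Y : Type) where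
  | output (y : Y)
  | send (i : Fin s) (b : Bool) (next : CoordStrategy s Y)
  | receive (i : Fin s) (next : Bool → CoordStrategy s Y)

/-- The execution of a strategy of the coordinator.  `reply i h` is the bit which player `i` sends
when it is its turn to speak and the past communication on its own link is `h`; `hist i` is the
communication on link `i` so far.  The result is the output of the coordinator together with the
total number of bits sent (in both directions, over all links). -/
def CoordStrategy.run {s : ℕ} {Y : Type} (reply : Fin s → List LinkEvent → Bool) :
    CoordStrategy s Y → (Fin s → List LinkEvent) → Y × ℕ
  | .output y, _ => (y, 0)
  | .send i b next, hist =>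
      let r := next.run reply (Function.update hist i (hist i ++ [LinkEvent.received b]))
      (r.1, r.2 + 1)
  | .receive i next, hist =>
      let b := reply i (hist i)
      let r := (next b).run reply (Function.update hist i (hist i ++ [LinkEvent.sent b]))
      (r.1, r.2 + 1)

/-- A randomized protocol with private coins in the coordinator model with `s` players, where the
inputs of the players are in `X` and the output of the coordinator is in `Y`.  Every party draws
its coins uniformly from a finite nonempty set of its own.  The coordinator's behaviour depends on
its coins and on what it has received; the bits of player `i` depend on its coins, its input and
the past communication on its own link only. -/
structure CoordProtocol (s : ℕ) (X Y : Type) where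
  CoordCoins : Type
  PlayerCoins : Fin s → Type
  coordFinite : Finite CoordCoins
  coordNonempty : Nonempty CoordCoins
  playerFinite : ∀ i, Finite (PlayerCoins i)
  playerNonempty : ∀ i, Nonempty (PlayerCoins i)
  coordinator : CoordCoins → CoordStrategy s Y
  player : (i : Fin s) → PlayerCoins i → X → List LinkEvent → Bool

namespace CoordProtocol

variable {s : ℕ} {X Y : Type}

/-- The joint outcomes of the coins of all parties (independent, hence uniformly distributed). -/
abbrev Coins (P : CoordProtocol s X Y) : Type :=
  P.CoordCoins × ((i : Fin s) → P.PlayerCoins i)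

/-- The coordinator's output and the number of bits sent, on input `x` with coins `ω`. -/
def exec (P : CoordProtocol s X Y) (x : Fin s → X) (ω : P.Coins) : Y × ℕ :=
  (P.coordinator ω.1).run (fun i => P.player i (ω.2 i) (x i)) (fun _ => [])

/-- The output of the coordinator on input `x` with coins `ω`. -/
def result (P : CoordProtocol s X Y) (x : Fin s → X) (ω : P.Coins) : Y :=
  (P.exec x ω).1

/-- The total number of bits sent on input `x` with coins `ω`. -/
def bits (P : CoordProtocol s X Y) (x : Fin s → X) (ω : P.Coins) : ℕ :=
  (P.exec x ω).2

/-- The probability of the event `A` over the coins of all parties. -/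
noncomputable def prob (P : CoordProtocol s X Y) (A : P.Coins → Prop) : ℝ :=
  (Nat.card {ω : P.Coins // A ω} : ℝ) / (Nat.card P.Coins : ℝ)

end CoordProtocol

/-! ### Spanners and distributed graphs -/

/-- `H` is a multiplicative `α`-spanner of `G`: a subgraph (on the same vertex set) with
`d_H(u, v) ≤ α * d_G(u, v)` for all vertices `u`, `v`, where the distance between vertices in
different connected components is infinite. -/
def IsMulSpanner {V : Type} (α : ℕ) (G H : SimpleGraph V) : Prop :=
  H ≤ G ∧ ∀ u v : V, H.edist u v ≤ (α : ℕ∞) * G.edist u v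

/-- The edge sets of the players are pairwise disjoint. -/
def WithoutDuplication {V : Type} {s : ℕ} (E : Fin s → SimpleGraph V) : Prop :=
  ∀ i j : Fin s, i ≠ j → Disjoint (E i).edgeSet (E j).edgeSet

/-- The randomized communication cost of the multiplicative `α`-spanner problem without edge
duplication, with `s` players, on the vertex set `{0, …, n - 1}`, with error probability at most
`δ`, is at most `B` bits: there is a protocol which, on every distribution of edges over the
players without duplication, never uses more than `B` bits, and whose output is, with probability
at least `1 - δ`, an `α`-spanner of the graph whose edges are those held by the players. -/
def SpannerCostWithoutDuplicationLE (n s α : ℕ) (δ B : ℝ) : Prop :=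
  ∃ P : CoordProtocol s (SimpleGraph (Fin n)) (SimpleGraph (Fin n)),
    ∀ E : Fin s → SimpleGraph (Fin n), WithoutDuplication E →
      (∀ ω : P.Coins, (P.bits E ω : ℝ) ≤ B) ∧
        1 - δ ≤ P.prob (fun ω => IsMulSpanner α (⨆ i, E i) (P.result E ω))

/-! ### Protocols in rounds

In every round the coordinator sends the same finite list of commands to every player, and every
player answers with a list of items which depends on its input and on a public state determined by
the commands. -/

/-! The protocol is deterministic and never errs. Put `k = t + 3` and let `X` solve `X ^ k = s ^ (k
- 2) * n`. Starting from singletons, `t + 1` levels of clustering are carried out. In a level, every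
current cluster `A` is queried: each player reports, for every vertex that is still clustered but
not yet in a new cluster, one of its edges into `A`. If at least `M` edges arrive, the reporting
vertices form a new cluster around `A`, of radius one larger. All reported edges are kept, so a
vertex left out of the new clusters has an edge into every adjacent cluster, and its edges have
stretch `2 * d + 1` when the radius is `d`.

A failed query costs fewer than `M` reports; a successful one is charged to the vertices that join.
In the first level a vertex has a single edge to a singleton, so without duplication `M` reports
mean `M` vertices and at most `n / X` clusters remain. Later up to `s` players may report the same
vertex, and each level loses a factor `s`. With threshold `X ^ (j + 1) / s ^ (j - 1)` at level `j ≥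
1`, failures cost `n * X` per level and `s ^ t * n / X ^ (t + 1)` clusters remain after level `t`.

Finally each player reports an edge for every adjacent pair of a radius-one cluster and a final
cluster. This gives stretch `3 + 2 * (t + 1) = 2 * k - 1` and costs again `n * X`, by the choice of
`X`. The carrying lemmas are `LevelInvariant.step`, `stage_level`, `stage_levels` and `stage_final`;
`stateRun_compile` turns rounds into bits. -/

/-- Adding `c` bits to the cost of an execution. -/
def charge {Y : Type} (c : ℕ) (r : Y × ℕ) : Y × ℕ := (r.1, r.2 + c)

@[simp] theorem charge_charge {Y : Type} (c d : ℕ) (r : Y × ℕ) :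
    charge c (charge d r) = charge (d + c) r := by
  simp [charge, add_assoc]

theorem charge_zero {Y : Type} (r : Y × ℕ) : charge 0 r = r := rfl

/-- What a player knows about its link: the public state, the number of items sent since the last
command, and the bits of the word which is being transmitted. -/
structure LinkState (σ : Type) where
  pub : σ
  count : ℕ
  word : List Bool

/-- The data of a protocol in rounds: commands in `B` and items in `Option R` (with `none` closing
a list) are written as words of the same positive length. -/
structure RoundCode (σ B R X : Type) where
  width : ℕ
  width_pos : 0 < width
  encB : B → List Bool
  decB : List Bool → B
  encB_length : ∀ b, (encB b).length = width
  decB_encB : ∀ b, decB (encB b) = b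
  encR : Option R → List Bool
  decR : List Bool → Option R
  encR_length : ∀ r, (encR r).length = width
  decR_encR : ∀ r, decR (encR r) = r
  start : σ
  upd : σ → B → σ
  reply : X → σ → List R
  bound : ℕ
  reply_le : ∀ x p, (reply x p).length ≤ bound

/-- A strategy of the coordinator in rounds. -/
inductive RoundStrategy (s : ℕ) (B R Y : Type) where
  | output (y : Y)
  | round (bs : List B) (b : B) (next : (Fin s → List R) → RoundStrategy s B R Y)

namespace RoundCode

variable {σ B R X Y : Type} {s : ℕ} (P : RoundCode σ B R X)

/-- The output of a strategy in rounds, and the number of words transmitted. -/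
def roundRun (x : Fin s → X) : RoundStrategy s B R Y → σ → Y × ℕ
  | .output y, _ => (y, 0)
  | .round bs b next, p =>
      let p' := (bs ++ [b]).foldl P.upd p
      charge (∑ i, ((bs ++ [b]).length + ((P.reply (x i) p').length + 1)))
        (roundRun x (next fun i => P.reply (x i) p') p')

/-! ### Simulation of rounds bit by bit -/

/-- The effect of one bit on what a player knows about its link. -/
def advance (S : LinkState σ) : LinkEvent → LinkState σ
  | .received b =>
      if (S.word ++ [b]).length = P.width then ⟨P.upd S.pub (P.decB (S.word ++ [b])), 0, []⟩
      else ⟨S.pub, S.count, S.word ++ [b]⟩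
  | .sent b =>
      if (S.word ++ [b]).length = P.width then ⟨S.pub, S.count + 1, []⟩
      else ⟨S.pub, S.count, S.word ++ [b]⟩

/-- The bit which a player sends. -/
def bit (x : X) (S : LinkState σ) : Bool :=
  -- Past the end of the list the lookup yields `none`, which is the closing item. The default
  -- `false` plays no role while a word is incomplete.
  (P.encR ((P.reply x S.pub)[S.count]?)).getD S.word.length false

/-- What a player knows after a given communication on its link. -/
def linkState (h : List LinkEvent) : LinkState σ := h.foldl P.advance ⟨P.start, 0, []⟩

/-- The execution of a strategy in terms of what the players know. -/
def stateRun (x : Fin s → X) : CoordStrategy s Y → (Fin s → LinkState σ) → Y × ℕ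
  | .output y, _ => (y, 0)
  | .send i b next, S =>
      charge 1 (stateRun x next (Function.update S i (P.advance (S i) (.received b))))
  | .receive i next, S =>
      charge 1 (stateRun x (next (P.bit (x i) (S i)))
        (Function.update S i (P.advance (S i) (.sent (P.bit (x i) (S i))))))

theorem linkState_update (hist : Fin s → List LinkEvent) (i : Fin s) (e : LinkEvent) :
    (fun j => P.linkState (Function.update hist i (hist i ++ [e]) j)) =
      Function.update (fun j => P.linkState (hist j)) i
        (P.advance (P.linkState (hist i)) e) := by
  funext j
  by_cases h : j = i
  · subst h; simp [linkState]
  · simp [h]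

/-- A player's bit depends on its link history only through a left fold, so histories can be
replaced by fold states that are updated in place. -/
theorem run_eq_stateRun (x : Fin s → X) (c : CoordStrategy s Y)
    (hist : Fin s → List LinkEvent) :
    c.run (fun i h => P.bit (x i) (P.linkState h)) hist =
      P.stateRun x c (fun i => P.linkState (hist i)) := by
  induction c generalizing hist with
  | output y => rfl
  | send i b next ih =>
      simp only [CoordStrategy.run, stateRun, ih, linkState_update, charge]
  | receive i next ih =>
      simp only [CoordStrategy.run, stateRun, ih, linkState_update, charge]

/-- Sending a list of bits to a player. -/
def sendBits (i : Fin s) (l : List Bool) (next : CoordStrategy s Y) : CoordStrategy s Y :=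
  l.foldr (fun b c => .send i b c) next

theorem stateRun_sendBits (x : Fin s → X) (i : Fin s) (l : List Bool)
    (next : CoordStrategy s Y) (S : Fin s → LinkState σ) :
    P.stateRun x (sendBits i l next) S =
      charge l.length (P.stateRun x next
        (Function.update S i ((l.map LinkEvent.received).foldl P.advance (S i)))) := by
  induction l generalizing S with
  | nil => simp [sendBits, charge_zero]
  | cons b l ih =>
      have := ih (Function.update S i (P.advance (S i) (.received b)))
      simp only [sendBits] at this
      simp [sendBits, stateRun, this]

theorem foldl_advance_received (l : List Bool) (S : LinkState σ) (hl : l ≠ [])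
    (h : S.word.length + l.length = P.width) :
    (l.map LinkEvent.received).foldl P.advance S =
      ⟨P.upd S.pub (P.decB (S.word ++ l)), 0, []⟩ := by
  induction l generalizing S with
  | nil => exact absurd rfl hl
  | cons b l ih =>
      rcases eq_or_ne l [] with rfl | hl'
      · have : S.word.length + 1 = P.width := by simpa using h
        simp [advance, this]
      · have h1 : S.word.length + 1 ≠ P.width := by
          have := List.length_pos_iff.2 hl'
          simp only [List.length_cons] at h
          omega
        rw [List.map_cons, List.foldl_cons]
        have h2 : P.advance S (.received b) = ⟨S.pub, S.count, S.word ++ [b]⟩ := by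
          simp [advance, h1]
        rw [h2, ih _ hl' (by simp at h ⊢; omega)]
        simp

/-- At least one command is needed to reset the item count; this is why a round always carries a
command `b` besides the list `bs`. -/
theorem foldl_advance_commands (bs : List B) (S : LinkState σ) (hS : S.word = []) (hbs : bs ≠ []) :
    ((bs.flatMap P.encB).map LinkEvent.received).foldl P.advance S =
      ⟨bs.foldl P.upd S.pub, 0, []⟩ := by
  induction bs generalizing S with
  | nil => exact absurd rfl hbs
  | cons b bs ih =>
      have h1 : ((P.encB b).map LinkEvent.received).foldl P.advance S =
          ⟨P.upd S.pub b, 0, []⟩ := by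
        have hne : P.encB b ≠ [] := by
          rw [← List.length_pos_iff, P.encB_length]; exact P.width_pos
        rw [P.foldl_advance_received _ S hne (by simp [hS, P.encB_length])]
        simp [hS, P.decB_encB]
      rw [List.flatMap_cons, List.map_append, List.foldl_append, h1, List.foldl_cons]
      rcases eq_or_ne bs [] with rfl | hbs'
      · simp
      · exact ih _ rfl hbs'

/-- Receiving `m` further bits from a player. -/
def recvBits (i : Fin s) : ℕ → List Bool → (List Bool → CoordStrategy s Y) → CoordStrategy s Y
  | 0, acc, next => next acc
  | m + 1, acc, next => .receive i fun b => recvBits i m (acc ++ [b]) next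

/-- The induction runs over a partially transmitted word: the coordinator's accumulator and the
player's `word` are the same prefix of the encoded item. -/
theorem stateRun_recvBits (x : Fin s → X) (i : Fin s) (m : ℕ) (next : List Bool → CoordStrategy s Y)
    (S : Fin s → LinkState σ) (hm : 0 < m) (h : (S i).word.length + m = P.width)
    (hw : (S i).word <+: P.encR ((P.reply (x i) (S i).pub)[(S i).count]?)) :
    P.stateRun x (recvBits i m (S i).word next) S =
      charge m (P.stateRun x (next (P.encR ((P.reply (x i) (S i).pub)[(S i).count]?)))
        (Function.update S i ⟨(S i).pub, (S i).count + 1, []⟩)) := by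
  induction m generalizing S with
  | zero => exact absurd hm (lt_irrefl 0)
  | succ m ih =>
      obtain ⟨t, ht⟩ := hw
      have hlen := P.encR_length ((P.reply (x i) (S i).pub)[(S i).count]?)
      rw [← ht, List.length_append] at hlen
      obtain ⟨b, t', rfl⟩ : ∃ b t', t = b :: t' := by
        cases t with
        | nil => simp at hlen; omega
        | cons b t' => exact ⟨b, t', rfl⟩
      have hb : P.bit (x i) (S i) = b := by
        simp [bit, ← ht]
      rw [recvBits, stateRun, hb]
      rcases Nat.eq_zero_or_pos m with rfl | hm'
      · have ht' : t' = [] := by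
          apply List.eq_nil_of_length_eq_zero
          simp at hlen; omega
        subst ht'
        have : P.advance (S i) (.sent b) = ⟨(S i).pub, (S i).count + 1, []⟩ := by
          simp [advance]; omega
        rw [recvBits, this, ht]
      · have h2 : P.advance (S i) (.sent b) = ⟨(S i).pub, (S i).count, (S i).word ++ [b]⟩ := by
          simp [advance]; omega
        rw [h2]
        have := ih (Function.update S i ⟨(S i).pub, (S i).count, (S i).word ++ [b]⟩) hm'
          (by simp; omega) (by simpa using ⟨t', by simpa using ht⟩)
        simp only [Function.update_self, Function.update_idem] at this
        rw [this, charge_charge]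

/-- Receiving a list of at most `m` items from a player. -/
def recvList (i : Fin s) : ℕ → List R → (List R → CoordStrategy s Y) → CoordStrategy s Y
  -- Not reached when `m` exceeds the number of items, since the closing item stops the recursion;
  -- hence `P.bound + 1` in `exchange`.
  | 0, acc, next => next acc
  | m + 1, acc, next => recvBits i P.width [] fun w =>
      match P.decR w with
      | none => next acc
      | some r => recvList i m (acc ++ [r]) next

theorem stateRun_recvList (x : Fin s → X) (i : Fin s) (m : ℕ) (next : List R → CoordStrategy s Y)
    (S : Fin s → LinkState σ) (hw : (S i).word = [])
    (hc : (S i).count ≤ (P.reply (x i) (S i).pub).length)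
    (hm : (P.reply (x i) (S i).pub).length < (S i).count + m) :
    P.stateRun x (P.recvList i m ((P.reply (x i) (S i).pub).take (S i).count) next) S =
      charge (P.width * ((P.reply (x i) (S i).pub).length - (S i).count + 1))
        (P.stateRun x (next (P.reply (x i) (S i).pub))
          (Function.update S i ⟨(S i).pub, (P.reply (x i) (S i).pub).length + 1, []⟩)) := by
  induction m generalizing S with
  | zero => omega
  | succ m ih =>
      rw [recvList]
      have := P.stateRun_recvBits x i P.width (fun w =>
        match P.decR w with
        | none => next ((P.reply (x i) (S i).pub).take (S i).count)
        | some r => P.recvList i m ((P.reply (x i) (S i).pub).take (S i).count ++ [r]) next) S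
        P.width_pos (by simp [hw]) (by simp [hw])
      rw [hw] at this
      rw [this]
      simp only [P.decR_encR]
      rcases hc.eq_or_lt with hc' | hc'
      · rw [List.getElem?_eq_none hc'.ge]
        simp [hc']
      · rw [List.getElem?_eq_getElem hc']
        have h3 := ih (Function.update S i ⟨(S i).pub, (S i).count + 1, []⟩) (by simp)
          (by simpa using hc') (by simp; omega)
        simp only [Function.update_self, Function.update_idem] at h3
        simp only [List.take_concat_get' _ _ hc']
        rw [h3, charge_charge, ← Nat.mul_succ]
        congr 2
        omega

/-- Sending the commands `bs` to the given players in turn, and receiving their answers. -/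
def exchange (bs : List B) : List (Fin s) → (Fin s → List R) →
    ((Fin s → List R) → CoordStrategy s Y) → CoordStrategy s Y
  | [], acc, next => next acc
  | i :: is, acc, next => sendBits i (bs.flatMap P.encB) <|
      P.recvList i (P.bound + 1) [] fun l => exchange bs is (Function.update acc i l) next

theorem length_flatMap_encB (bs : List B) : (bs.flatMap P.encB).length = P.width * bs.length := by
  simp [List.length_flatMap, P.encB_length, mul_comm]

/-- Players are served one after another: those in `is` still hold the old public state, the others
hold the new one and their answers are already in `acc`. -/
theorem stateRun_exchange (x : Fin s → X) (bs : List B) (hbs : bs ≠ []) (p : σ)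
    (is : List (Fin s)) (his : is.Nodup) (acc : Fin s → List R)
    (next : (Fin s → List R) → CoordStrategy s Y) (S : Fin s → LinkState σ)
    (hS : ∀ i, (S i).word = []) (hp : ∀ i ∈ is, (S i).pub = p)
    (hq : ∀ i ∉ is, (S i).pub = bs.foldl P.upd p)
    (hacc : ∀ i ∉ is, acc i = P.reply (x i) (bs.foldl P.upd p)) :
    ∃ S' : Fin s → LinkState σ, (∀ i, (S' i).word = [] ∧ (S' i).pub = bs.foldl P.upd p) ∧
      P.stateRun x (P.exchange bs is acc next) S =
        charge (is.map fun i => P.width *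
            (bs.length + ((P.reply (x i) (bs.foldl P.upd p)).length + 1))).sum
          (P.stateRun x (next fun i => P.reply (x i) (bs.foldl P.upd p)) S') := by
  induction is generalizing acc S with
  | nil =>
      refine ⟨S, fun i => ⟨hS i, hq i (by simp)⟩, ?_⟩
      have : acc = fun i => P.reply (x i) (bs.foldl P.upd p) := funext fun i => hacc i (by simp)
      simp [exchange, this, charge_zero]
  | cons i is ih =>
      obtain ⟨hi, hnd⟩ := List.nodup_cons.1 his
      set p' := bs.foldl P.upd p with hp'
      have h1 := P.stateRun_recvList x i (P.bound + 1)
        (fun l => P.exchange bs is (Function.update acc i l) next)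
        (Function.update S i ⟨p', 0, []⟩) (by simp) (by simp)
        (by simpa using P.reply_le (x i) p')
      simp only [Function.update_self, Function.update_idem, List.take_zero] at h1
      obtain ⟨S', hS', h2⟩ := ih hnd (Function.update acc i (P.reply (x i) p'))
        (Function.update S i ⟨p', (P.reply (x i) p').length + 1, []⟩)
        (fun j => by by_cases h : j = i <;> simp [h, hS])
        (fun j hj => by
          have h : j ≠ i := by rintro rfl; exact hi hj
          simpa [h] using hp j (by simp [hj]))
        (fun j hj => by
          by_cases h : j = i
          · simp [h]
          · simpa [h] using hq j (by simp [hj, h]))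
        (fun j hj => by
          by_cases h : j = i
          · subst h; simp
          · simpa [h] using hacc j (by simp [hj, h]))
      refine ⟨S', hS', ?_⟩
      rw [exchange, P.stateRun_sendBits, P.foldl_advance_commands bs (S i) (hS i) hbs,
        hp i (by simp), ← hp', h1, h2, charge_charge, charge_charge, length_flatMap_encB]
      congr 1
      simp only [List.map_cons, List.sum_cons, Nat.sub_zero]
      ring

/-- The strategy of the coordinator which carries out a strategy in rounds. -/
def compile : RoundStrategy s B R Y → CoordStrategy s Y
  | .output y => .output y
  | .round bs b next =>
      P.exchange (bs ++ [b]) (List.finRange s) (fun _ => []) fun r => compile (next r)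

theorem stateRun_compile (x : Fin s → X) (c : RoundStrategy s B R Y) (p : σ)
    (S : Fin s → LinkState σ) (hS : ∀ i, (S i).word = [] ∧ (S i).pub = p) :
    P.stateRun x (P.compile c) S =
      ((P.roundRun x c p).1, P.width * (P.roundRun x c p).2) := by
  induction c generalizing p S with
  | output y => simp [compile, stateRun, roundRun]
  | round bs b next ih =>
      obtain ⟨S', hS', h⟩ := P.stateRun_exchange x (bs ++ [b]) (by simp) p (List.finRange s)
        (List.nodup_finRange s) (fun _ => []) (fun r => P.compile (next r)) S
        (fun i => (hS i).1) (fun i _ => (hS i).2) (fun i hi => absurd (List.mem_finRange i) hi)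
        (fun i hi => absurd (List.mem_finRange i) hi)
      rw [compile, h, ih _ _ _ hS']
      simp only [charge, roundRun, Prod.mk.injEq, true_and]
      rw [← List.ofFn_eq_map, List.sum_ofFn, mul_add, Finset.mul_sum]

/-- The deterministic protocol carrying out a strategy in rounds. -/
def toProtocol (c : RoundStrategy s B R Y) : CoordProtocol s X Y where
  CoordCoins := Unit
  PlayerCoins := fun _ => Unit
  coordFinite := inferInstance
  coordNonempty := inferInstance
  playerFinite := fun _ => inferInstance
  playerNonempty := fun _ => inferInstance
  coordinator := fun _ => P.compile c
  player := fun _ _ x h => P.bit x (P.linkState h)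

theorem toProtocol_exec (c : RoundStrategy s B R Y) (x : Fin s → X)
    (ω : (P.toProtocol c).Coins) :
    (P.toProtocol c).exec x ω =
      ((P.roundRun x c P.start).1, P.width * (P.roundRun x c P.start).2) := by
  unfold CoordProtocol.exec
  exact (P.run_eq_stateRun x (P.compile c) fun _ => []).trans
    (P.stateRun_compile x c P.start _ fun i => ⟨rfl, rfl⟩)

end RoundCode

/-- An event which always holds has probability one. -/
theorem CoordProtocol.prob_eq_one {s : ℕ} {X Y : Type} (P : CoordProtocol s X Y)
    {A : P.Coins → Prop} (hA : ∀ ω, A ω) : P.prob A = 1 := by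
  have := P.coordFinite
  have := P.coordNonempty
  have := P.playerFinite
  have := P.playerNonempty
  have h : Nat.card {ω : P.Coins // A ω} = Nat.card P.Coins :=
    Nat.card_congr (Equiv.subtypeUnivEquiv hA)
  rw [CoordProtocol.prob, h, div_self]
  exact_mod_cast Nat.card_pos.ne'

/-- A type which embeds into a finite type with at most `2 ^ m` elements can be encoded in words of
`m` bits. -/
theorem exists_word_code {T S : Type} [Fintype S] [Nonempty T] {f : T → S}
    (hf : Function.Injective f) {m : ℕ} (h : Fintype.card S ≤ 2 ^ m) :
    ∃ (enc : T → List Bool) (dec : List Bool → T),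
      (∀ t, (enc t).length = m) ∧ ∀ t, dec (enc t) = t := by
  have h' : Fintype.card S ≤ Fintype.card (Fin m → Bool) := by simpa using h
  obtain ⟨g⟩ := Function.Embedding.nonempty_of_card_le h'
  have hinj : Function.Injective fun t => List.ofFn (g (f t)) :=
    List.ofFn_injective.comp (g.injective.comp hf)
  exact ⟨_, Function.invFun fun t => List.ofFn (g (f t)), fun t => by simp,
    Function.leftInverse_invFun hinj⟩

/-! ### The clustering protocol -/

/-- A list containing one item related to each index which is related to some item. -/
noncomputable def representatives {ι ε : Type} [Fintype ι] [Nonempty ε] (r : ι → ε → Prop) :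
    List ε :=
  open Classical in (Finset.univ.filter fun i => ∃ e, r i e).toList.map fun i =>
    Classical.epsilon (r i)

section representatives

variable {ι ε : Type} [Fintype ι] [Nonempty ε] {r : ι → ε → Prop}

open Classical in
theorem length_representatives :
    (representatives r).length = (Finset.univ.filter fun i => ∃ e, r i e).card := by
  simp [representatives]

theorem exists_of_mem_representatives {e : ε} (he : e ∈ representatives r) : ∃ i, r i e := by
  classical
  simp only [representatives, List.mem_map, Finset.mem_toList, Finset.mem_filter,
    Finset.mem_univ, true_and] at he
  obtain ⟨i, hi, rfl⟩ := he
  exact ⟨i, Classical.epsilon_spec hi⟩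

theorem exists_mem_representatives {i : ι} {e : ε} (h : r i e) :
    ∃ e' ∈ representatives r, r i e' := by
  classical
  refine ⟨Classical.epsilon (r i), ?_, Classical.epsilon_spec ⟨e, h⟩⟩
  simp only [representatives, List.mem_map, Finset.mem_toList, Finset.mem_filter,
    Finset.mem_univ, true_and]
  exact ⟨i, ⟨e, h⟩, rfl⟩

end representatives

/-- The commands of the coordinator in the clustering protocol. -/
inductive ClusterCommand (V : Type) where
  /-- the vertex `v` joins the new cluster with center `A` -/
  | assign (v A : V)
  /-- the players report edges into the cluster with center `A` -/
  | query (A : V)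
  /-- the new clusters become the current ones -/
  | next (first : Bool)
  /-- the players report edges between clusters of radius one and current clusters -/
  | final

/-- The public state of the clustering protocol.  Clusters are given by the centers of their
members; `one` are the clusters of radius one, `cur` the current ones and `nxt` the new ones. -/
structure Clustering (V : Type) where
  one : V → Option V
  cur : V → Option V
  nxt : V → Option V
  last : ClusterCommand V

/-- The graph whose edges are the given pairs. -/
def graphOfList {V : Type} (es : List (V × V)) : SimpleGraph V :=
  SimpleGraph.fromRel fun u v => (u, v) ∈ es

theorem graphOfList_mono {V : Type} {es es' : List (V × V)} (h : es ⊆ es') :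
    graphOfList es ≤ graphOfList es' := by
  intro u v huv
  simp only [graphOfList, SimpleGraph.fromRel_adj] at huv ⊢
  exact ⟨huv.1, huv.2.imp (@h _) (@h _)⟩

theorem graphOfList_le {V : Type} {es : List (V × V)} {G : SimpleGraph V}
    (h : ∀ e ∈ es, G.Adj e.1 e.2) : graphOfList es ≤ G := by
  intro u v huv
  simp only [graphOfList, SimpleGraph.fromRel_adj] at huv
  exact huv.2.elim (h _) fun h' => (h _ h').symm

theorem edist_graphOfList_le_one {V : Type} {es : List (V × V)} {e : V × V} (he : e ∈ es)
    (hne : e.1 ≠ e.2) : (graphOfList es).edist e.1 e.2 ≤ 1 := by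
  have : (graphOfList es).Adj e.1 e.2 := by
    simp only [graphOfList, SimpleGraph.fromRel_adj]
    exact ⟨hne, Or.inl he⟩
  exact (SimpleGraph.edist_eq_one_iff_adj.2 this).le

namespace Clustering

variable {V : Type}

/-- The effect of a command on the public state. -/
def upd [DecidableEq V] (p : Clustering V) (b : ClusterCommand V) : Clustering V :=
  match b with
  | .assign v A => { p with nxt := Function.update p.nxt v (some A), last := b }
  | .query _ => { p with last := b }
  | .next first =>
      { one := if first then p.nxt else p.one, cur := p.nxt, nxt := fun _ => none, last := b }
  | .final => { p with last := b }

theorem foldl_assign [DecidableEq V] (vs : List V) (A : V) (p : Clustering V) :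
    ((vs.map fun v => ClusterCommand.assign v A).foldl upd p).one = p.one ∧
    ((vs.map fun v => ClusterCommand.assign v A).foldl upd p).cur = p.cur ∧
    ((vs.map fun v => ClusterCommand.assign v A).foldl upd p).nxt =
      fun v => if v ∈ vs then some A else p.nxt v := by
  induction vs generalizing p with
  | nil => simp
  | cons w vs ih =>
      obtain ⟨h1, h2, h3⟩ := ih (p.upd (.assign w A))
      rw [List.map_cons, List.foldl_cons]
      refine ⟨h1, h2, h3.trans ?_⟩
      funext v
      by_cases hv : v = w
      · simp [hv, upd]
      · simp [hv, upd]

/-- The edge `e` leads from the vertex `v`, which is not in a new cluster, to the current cluster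
with center `A`. -/
def IsLink (E : SimpleGraph V) (p : Clustering V) (A v : V) (e : V × V) : Prop :=
  -- The vertex `v` may itself lie in the cluster `A`, so edges inside a cluster are treated like
  -- all others.
  e.1 = v ∧ E.Adj e.1 e.2 ∧ p.cur e.1 ≠ none ∧ p.nxt e.1 = none ∧ p.cur e.2 = some A

/-- The edge `e` joins given clusters of the two kinds. -/
def IsBridge (E : SimpleGraph V) (p : Clustering V) (q : V × V) (e : V × V) : Prop :=
  E.Adj e.1 e.2 ∧ p.one e.1 = some q.1 ∧ p.cur e.2 = some q.2

variable [Fintype V] [Nonempty V]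

/-- The answer of a player to the last command. -/
noncomputable def reply (E : SimpleGraph V) (p : Clustering V) : List (V × V) :=
  match p.last with
  | .query A => representatives (IsLink E p A)
  | .final => representatives (IsBridge E p)
  | _ => []

/-- This crude bound only makes the coordinator's decision tree finite; the cost uses the actual
lengths. -/
theorem length_reply_le (E : SimpleGraph V) (p : Clustering V) :
    (reply E p).length ≤ Fintype.card V + Fintype.card (V × V) := by
  classical
  unfold reply
  split
  · rw [length_representatives]
    exact (Finset.card_le_univ _).trans (Nat.le_add_right _ _)
  · rw [length_representatives]
    exact (Finset.card_le_univ _).trans (Nat.le_add_left _ _)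
  · simp

/-- The answers of all players to the last command. -/
noncomputable def replies {s : ℕ} (E : Fin s → SimpleGraph V) (p : Clustering V) : List (V × V) :=
  (List.ofFn fun j => reply (E j) p).flatten

theorem mem_replies {s : ℕ} {E : Fin s → SimpleGraph V} {p : Clustering V} {e : V × V} :
    e ∈ replies E p ↔ ∃ j, e ∈ reply (E j) p := by
  simp only [replies, List.mem_flatten, List.mem_ofFn]
  constructor
  · rintro ⟨l, ⟨j, rfl⟩, h⟩; exact ⟨j, h⟩
  · rintro ⟨j, h⟩; exact ⟨_, ⟨j, rfl⟩, h⟩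

theorem length_replies {s : ℕ} (E : Fin s → SimpleGraph V) (p : Clustering V) :
    (replies E p).length = ∑ j, (reply (E j) p).length := by
  simp [replies, List.length_flatten, List.map_ofFn, List.sum_ofFn, Function.comp_def]

end Clustering

/-! ### The coordinator's strategy and its word count -/

section Strategy

open Clustering

variable {V : Type} [DecidableEq V]

/-- The commands which form a new cluster with center `A` when at least `M` edges into the cluster
with center `A` have been reported. -/
noncomputable def newCluster (b : ClusterCommand V) (M : ℝ) (l : List (V × V)) :
    List (ClusterCommand V) :=
  match b with
  | .query A =>
      -- The threshold counts reports with multiplicity over the players, not distinct vertices.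
      if M ≤ l.length then (l.map Prod.fst).dedup.map fun v => ClusterCommand.assign v A else []
  | _ => []

/-- The strategy of the coordinator which issues the given commands, with the given thresholds for
forming new clusters, and outputs all reported edges. -/
noncomputable def clusterStrategy (s : ℕ) : List (ClusterCommand V × ℝ) →
    List (ClusterCommand V) → List (V × V) →
    RoundStrategy s (ClusterCommand V) (V × V) (SimpleGraph V)
  | [], _, es => .output (graphOfList es)
  | w :: ws, bs, es => .round bs w.1 fun r =>
      clusterStrategy s ws (newCluster w.1 w.2 (List.ofFn r).flatten) (es ++ (List.ofFn r).flatten)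

/-- A configuration of the clustering protocol: the public state, the reported edges and the number
of words sent. -/
structure Configuration (V : Type) where
  pub : Clustering V
  edges : List (V × V)
  words : ℕ

variable [Fintype V] [Nonempty V] {s : ℕ}

/-- The effect of a command, including the formation of a new cluster. -/
noncomputable def Configuration.step (E : Fin s → SimpleGraph V) (c : Configuration V)
    (w : ClusterCommand V × ℝ) : Configuration V where
  pub := (newCluster w.1 w.2 (replies E (c.pub.upd w.1))).foldl upd (c.pub.upd w.1)
  edges := c.edges ++ replies E (c.pub.upd w.1)
  -- Per player there are two words for the command and the closing item. The assignments are
  -- charged here, although they are transmitted with the following command.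
  words := c.words + (s * ((newCluster w.1 w.2 (replies E (c.pub.upd w.1))).length + 2) +
    (replies E (c.pub.upd w.1)).length)

/-- The cost is only bounded because assignments still pending at the end are charged but never
sent. The pending commands `bs` account for `s * bs.length` words. -/
theorem roundRun_clusterStrategy
    (P : RoundCode (Clustering V) (ClusterCommand V) (V × V) (SimpleGraph V))
    (hupd : P.upd = upd) (hreply : P.reply = reply) (E : Fin s → SimpleGraph V)
    (ws : List (ClusterCommand V × ℝ)) (bs : List (ClusterCommand V)) (es : List (V × V))
    (p : Clustering V) (m : ℕ) :
    (P.roundRun E (clusterStrategy s ws bs es) p).1 =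
        graphOfList (ws.foldl (Configuration.step E) ⟨bs.foldl upd p, es, m⟩).edges ∧
      (P.roundRun E (clusterStrategy s ws bs es) p).2 + m ≤
        (ws.foldl (Configuration.step E) ⟨bs.foldl upd p, es, m⟩).words + s * bs.length := by
  induction ws generalizing bs es p m with
  | nil => simp [clusterStrategy, RoundCode.roundRun]
  | cons w ws ih =>
      set p₀ := bs.foldl upd p with hp₀
      have hp' : (bs ++ [w.1]).foldl P.upd p = p₀.upd w.1 := by
        rw [hupd, List.foldl_append, ← hp₀]; rfl
      have hl : (List.ofFn fun i => P.reply (E i) (p₀.upd w.1)).flatten =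
          replies E (p₀.upd w.1) := by rw [hreply]; rfl
      obtain ⟨h1, h2⟩ := ih (newCluster w.1 w.2 (replies E (p₀.upd w.1)))
        (es ++ replies E (p₀.upd w.1)) (p₀.upd w.1)
        (Configuration.step E ⟨p₀, es, m⟩ w).words
      simp only [clusterStrategy, RoundCode.roundRun, charge, hp', hl, List.foldl_cons]
      refine ⟨h1, ?_⟩
      have h3 : ∑ i, ((bs ++ [w.1]).length + ((P.reply (E i) (p₀.upd w.1)).length + 1)) =
          s * (bs.length + 2) + (replies E (p₀.upd w.1)).length := by
        rw [length_replies, hreply]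
        simp only [Finset.sum_add_distrib, Finset.sum_const, Finset.card_univ, Fintype.card_fin,
          smul_eq_mul, List.length_append, List.length_singleton]
        ring
      rw [h3]
      change _ ≤ (ws.foldl (Configuration.step E) (Configuration.step E ⟨p₀, es, m⟩ w)).words + _
      change _ ≤ (ws.foldl (Configuration.step E) (Configuration.step E ⟨p₀, es, m⟩ w)).words + _
        at h2
      have h4 : (Configuration.step E ⟨p₀, es, m⟩ w).words = m + (s *
          ((newCluster w.1 w.2 (replies E (p₀.upd w.1))).length + 2) +
            (replies E (p₀.upd w.1)).length) := rfl
      rw [h4] at h2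
      nlinarith

end Strategy

/-! ### One level of clustering -/

section Level

set_option linter.unusedSectionVars false

open Clustering Finset

variable {V : Type} [Fintype V] [DecidableEq V]

/-- The members of the cluster with center `A`. -/
def members (f : V → Option V) (A : V) : Finset V := univ.filter fun v => f v = some A

/-- The centers of nonempty clusters. -/
def centers (f : V → Option V) : Finset V := univ.filter fun A => ∃ v, f v = some A

/-- The vertices which belong to some cluster. -/
def clustered (f : V → Option V) : Finset V := univ.filter fun v => f v ≠ none

theorem mem_members {f : V → Option V} {A v : V} : v ∈ members f A ↔ f v = some A := by
  simp [members]

theorem mem_centers {f : V → Option V} {A : V} : A ∈ centers f ↔ ∃ v, f v = some A := by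
  simp [centers]

theorem mem_clustered {f : V → Option V} {v : V} : v ∈ clustered f ↔ f v ≠ none := by
  simp [clustered]

/-- If all clusters are large then there are few of them. -/
theorem mul_card_centers_le {f : V → Option V} {M : ℝ} {a : ℕ}
    (h : ∀ A v, f v = some A → M ≤ a * (members f A).card) :
    M * (centers f).card ≤ a * Fintype.card V := by
  have h1 : ∑ A ∈ centers f, (members f A).card ≤ Fintype.card V := by
    rw [← Finset.card_biUnion]
    · exact Finset.card_le_univ _
    · intro A _ B _ hAB
      rw [Function.onFun, Finset.disjoint_left]
      intro v hv hv'
      rw [mem_members] at hv hv'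
      exact hAB (Option.some.inj (hv.symm.trans hv'))
  have h2 : ∑ _A ∈ centers f, M ≤ ∑ A ∈ centers f, (a : ℝ) * (members f A).card := by
    refine Finset.sum_le_sum fun A hA => ?_
    obtain ⟨v, hv⟩ := mem_centers.1 hA
    exact h A v hv
  rw [Finset.sum_const, nsmul_eq_mul, ← Finset.mul_sum, mul_comm] at h2
  refine h2.trans (mul_le_mul_of_nonneg_left ?_ (Nat.cast_nonneg a))
  exact_mod_cast h1

open Classical in
/-- The vertices outside the new clusters which have a link to the cluster with center `A`. -/
noncomputable def linked (G : SimpleGraph V) (p : Clustering V) (A : V) : Finset V :=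
  univ.filter fun v => ∃ e, IsLink G p A v e

theorem mem_linked {G : SimpleGraph V} {p : Clustering V} {A v : V} :
    v ∈ linked G p A ↔ ∃ e, IsLink G p A v e := by
  simp [linked]

variable [Nonempty V] {s : ℕ} (E : Fin s → SimpleGraph V)

theorem reply_query (G : SimpleGraph V) (p : Clustering V) (A : V) :
    reply G (p.upd (.query A)) = representatives (IsLink G p A) := rfl

theorem linked_iSup (p : Clustering V) (A : V) :
    linked (⨆ j, E j) p A = univ.biUnion fun j => linked (E j) p A := by
  ext v
  simp only [mem_linked, mem_biUnion, mem_univ, true_and, IsLink, SimpleGraph.iSup_adj]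
  constructor
  · rintro ⟨e, h1, ⟨j, h2⟩, h3⟩; exact ⟨j, e, h1, h2, h3⟩
  · rintro ⟨j, e, h1, h2, h3⟩; exact ⟨e, h1, ⟨j, h2⟩, h3⟩

theorem length_replies_query (p : Clustering V) (A : V) :
    (replies E (p.upd (.query A))).length = ∑ j, (linked (E j) p A).card := by
  rw [length_replies]
  refine Finset.sum_congr rfl fun j _ => ?_
  rw [reply_query, length_representatives, linked]
  congr!

/-- Every linked vertex is reported by at most `s` players. -/
theorem length_replies_query_le (p : Clustering V) (A : V) :
    (replies E (p.upd (.query A))).length ≤ s * (linked (⨆ j, E j) p A).card := by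
  rw [length_replies_query]
  have h : ∀ j ∈ (univ : Finset (Fin s)),
      (linked (E j) p A).card ≤ (linked (⨆ j, E j) p A).card := fun j _ => by
    rw [linked_iSup]
    exact card_le_card (subset_biUnion_of_mem (fun j => linked (E j) p A) (mem_univ j))
  simpa using Finset.sum_le_card_nsmul _ _ _ h

/-- Without duplication, every vertex linked to a singleton cluster is reported only once. -/
theorem length_replies_query_singletons (hE : WithoutDuplication E) (p : Clustering V)
    (hp : p.cur = some) (A : V) :
    -- The factor `1` is the parameter `a` of the level at singletons; later levels have `a = s`.
    (replies E (p.upd (.query A))).length ≤ 1 * (linked (⨆ j, E j) p A).card := by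
  rw [length_replies_query, linked_iSup, card_biUnion, one_mul]
  intro i _ j _ hij
  rw [Function.onFun, Finset.disjoint_left]
  intro v hi hj
  rw [mem_linked] at hi hj
  obtain ⟨⟨v₁, x₁⟩, rfl, h1, -, -, h2⟩ := hi
  obtain ⟨⟨v₂, x₂⟩, h3, h4, -, -, h5⟩ := hj
  rw [hp] at h2 h5
  -- Both links end in `A` itself, so two players reporting `v` would hold the same edge.
  obtain rfl := Option.some.inj h2
  obtain rfl := Option.some.inj h5
  dsimp only at h1 h3 h4
  subst h3
  exact Set.disjoint_left.1 (hE i j hij) (SimpleGraph.mem_edgeSet _ |>.2 h1)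
    (SimpleGraph.mem_edgeSet _ |>.2 h4)

theorem mem_replies_query {p : Clustering V} {A : V} {e : V × V}
    (he : e ∈ replies E (p.upd (.query A))) : IsLink (⨆ j, E j) p A e.1 e := by
  obtain ⟨j, hj⟩ := mem_replies.1 he
  rw [reply_query] at hj
  obtain ⟨v, h1, h2, h3⟩ := exists_of_mem_representatives hj
  exact ⟨rfl, SimpleGraph.iSup_adj.2 ⟨j, h2⟩, h3⟩

theorem exists_mem_replies_query {p : Clustering V} {A v : V}
    (hv : v ∈ linked (⨆ j, E j) p A) : ∃ e ∈ replies E (p.upd (.query A)), e.1 = v := by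
  obtain ⟨e, h1, h2, h3⟩ := mem_linked.1 hv
  obtain ⟨j, hj⟩ := SimpleGraph.iSup_adj.1 h2
  obtain ⟨e', he', h⟩ := exists_mem_representatives
    (r := IsLink (E j) p A) (i := v) (e := e) ⟨h1, hj, h3⟩
  exact ⟨e', mem_replies.2 ⟨j, by rwa [reply_query]⟩, h.1⟩

theorem toFinset_map_replies_query (p : Clustering V) (A : V) :
    ((replies E (p.upd (.query A))).map Prod.fst).toFinset = linked (⨆ j, E j) p A := by
  ext v
  rw [List.mem_toFinset, List.mem_map]
  constructor
  · rintro ⟨e, he, rfl⟩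
    exact mem_linked.2 ⟨e, mem_replies_query E he⟩
  · exact exists_mem_replies_query E

/-- The effect of a query on the public state and the number of words. -/
theorem step_query (c : Configuration V) (A : V) (M : ℝ) :
    (c.step E (.query A, M)).pub.cur = c.pub.cur ∧
    (c.step E (.query A, M)).pub.one = c.pub.one ∧
    (c.step E (.query A, M)).edges = c.edges ++ replies E (c.pub.upd (.query A)) ∧
    ((M ≤ (replies E (c.pub.upd (.query A))).length ∧
      (c.step E (.query A, M)).pub.nxt =
        (fun v => if v ∈ linked (⨆ j, E j) c.pub A then some A else c.pub.nxt v) ∧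
      (c.step E (.query A, M)).words = c.words + (s * ((linked (⨆ j, E j) c.pub A).card + 2) +
        (replies E (c.pub.upd (.query A))).length)) ∨
    ((replies E (c.pub.upd (.query A))).length < M ∧
      (c.step E (.query A, M)).pub.nxt = c.pub.nxt ∧
      (c.step E (.query A, M)).words = c.words + (s * 2 +
        (replies E (c.pub.upd (.query A))).length))) := by
  set l := replies E (c.pub.upd (.query A)) with hl
  by_cases hM : M ≤ l.length
  · have hn : newCluster (.query A) M l =
        (l.map Prod.fst).dedup.map fun v => ClusterCommand.assign v A := by
      simp [newCluster, hM]
    obtain ⟨h1, h2, h3⟩ := foldl_assign (l.map Prod.fst).dedup A (c.pub.upd (.query A))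
    have hmem : ∀ v, v ∈ (l.map Prod.fst).dedup ↔ v ∈ linked (⨆ j, E j) c.pub A := fun v => by
      rw [← toFinset_map_replies_query, List.mem_dedup, List.mem_toFinset]
    have hcard : (l.map Prod.fst).dedup.length = (linked (⨆ j, E j) c.pub A).card := by
      rw [← toFinset_map_replies_query, List.card_toFinset]
    refine ⟨?_, ?_, rfl, Or.inl ⟨hM, ?_, ?_⟩⟩
    · simp only [Configuration.step, ← hl, hn, h2]; rfl
    · simp only [Configuration.step, ← hl, hn, h1]; rfl
    · simp only [Configuration.step, ← hl, hn, h3, hmem]; rfl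
    · simp only [Configuration.step, ← hl, hn, List.length_map, hcard]
  · have hn : newCluster (.query A) M l = [] := by simp [newCluster, hM]
    refine ⟨?_, ?_, rfl, Or.inr ⟨not_le.1 hM, ?_, ?_⟩⟩ <;>
      simp only [Configuration.step, ← hl, hn] <;> rfl

/-- The invariant while new clusters are formed from the clusters of the configuration `c₀`, whose
radius is at most `d`, after the clusters with centers in `L` have been processed. -/
structure LevelInvariant (c₀ : Configuration V) (d a : ℕ) (M : ℝ) (L : List V)
    (c : Configuration V) : Prop where
  cur_eq : c.pub.cur = c₀.pub.cur
  one_eq : c.pub.one = c₀.pub.one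
  edges_subset : c₀.edges ⊆ c.edges
  adj : ∀ e ∈ c.edges, (⨆ j, E j).Adj e.1 e.2
  nested : ∀ v, c.pub.nxt v ≠ none → c₀.pub.cur v ≠ none
  edist_le : ∀ v A, c.pub.nxt v = some A → (graphOfList c.edges).edist v A ≤ d + 1
  covered : ∀ A ∈ L, ∀ v x, c.pub.nxt v = none → c₀.pub.cur v ≠ none → (⨆ j, E j).Adj v x →
    c₀.pub.cur x = some A → ∃ e ∈ c.edges, e.1 = v ∧ c₀.pub.cur e.2 = some A
  large : ∀ A v, c.pub.nxt v = some A → M ≤ a * (members c.pub.nxt A).card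
  -- The three charges are the overhead of each query, the reports of failed queries to nonempty
  -- clusters, and, for each vertex that joined, at most `s` reports and `s` announcements.
  words_le : (c.words : ℝ) ≤ c₀.words + 2 * s * L.length +
    M * (L.filter fun A => A ∈ centers c₀.pub.cur).length +
    2 * s * (clustered c.pub.nxt).card

variable {E}

/-- The linked vertices `W` were in no new cluster, so a success leaves other new clusters intact
and pays for itself out of `W`. Reports are kept in both cases, which gives `covered` without a case
distinction. -/
theorem LevelInvariant.step {c₀ c : Configuration V} {d a : ℕ} {M : ℝ} {L : List V}
    (h : LevelInvariant E c₀ d a M L c) (hM : 0 ≤ M) (has : a ≤ s)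
    (hd : ∀ v A, c₀.pub.cur v = some A → (graphOfList c₀.edges).edist v A ≤ d)
    (ha : ∀ (p : Clustering V) (A : V), p.cur = c₀.pub.cur →
      (replies E (p.upd (.query A))).length ≤ a * (linked (⨆ j, E j) p A).card) (A : V) :
    LevelInvariant E c₀ d a M (L ++ [A]) (c.step E (.query A, M)) := by
  set l := replies E (c.pub.upd (.query A)) with hl
  set W := linked (⨆ j, E j) c.pub A with hW
  have hlW : l.length ≤ a * W.card := ha c.pub A h.cur_eq
  obtain ⟨hcur, hone, hedges, hcase⟩ := step_query E c A M
  rw [← hl] at hedges hcase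
  rw [← hW] at hcase
  set c' := c.step E (.query A, M) with hc'
  have hsub : c.edges ⊆ c'.edges := by rw [hedges]; exact List.subset_append_left _ _
  have hWnone : ∀ v ∈ W, c.pub.nxt v = none := fun v hv => by
    obtain ⟨e, rfl, -, -, h2, -⟩ := mem_linked.1 hv; exact h2
  have hadj : ∀ e ∈ c'.edges, (⨆ j, E j).Adj e.1 e.2 := fun e he => by
    rw [hedges, List.mem_append] at he
    exact he.elim (h.adj e) fun he => (mem_replies_query E he).2.1
  have hnone : ∀ v, c'.pub.nxt v = none → c.pub.nxt v = none := fun v hv => by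
    rcases hcase with ⟨-, h1, -⟩ | ⟨-, h1, -⟩
    · rw [h1] at hv
      by_cases hvW : v ∈ W
      · exact hWnone v hvW
      · simpa [hvW] using hv
    · rwa [h1] at hv
  have hmono : ∀ u v, (graphOfList c'.edges).edist u v ≤ (graphOfList c.edges).edist u v :=
    fun u v => SimpleGraph.edist_anti (graphOfList_mono hsub)
  have hWe : ∀ v ∈ W, ∃ e ∈ c'.edges, e.1 = v ∧ c₀.pub.cur e.2 = some A := fun v hv => by
    obtain ⟨e, he, hev⟩ := exists_mem_replies_query E hv
    refine ⟨e, by rw [hedges]; exact List.mem_append_right _ he, hev, ?_⟩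
    rw [← h.cur_eq]; exact (mem_replies_query E he).2.2.2.2
  have hWcur : ∀ v ∈ W, c₀.pub.cur v ≠ none := fun v hv => by
    obtain ⟨e, rfl, -, h1, -⟩ := mem_linked.1 hv
    rwa [← h.cur_eq]
  have hWd : ∀ v ∈ W, (graphOfList c'.edges).edist v A ≤ d + 1 := fun v hv => by
    obtain ⟨e, he, rfl, hx⟩ := hWe v hv
    have h1 := edist_graphOfList_le_one he (hadj e he).ne
    have h2 : (graphOfList c'.edges).edist e.2 A ≤ d :=
      (SimpleGraph.edist_anti (graphOfList_mono (List.Subset.trans h.edges_subset hsub))).trans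
        (hd _ _ hx)
    calc _ ≤ _ := SimpleGraph.edist_triangle
      _ ≤ 1 + (d : ℕ∞) := add_le_add h1 h2
      _ = _ := add_comm _ _
  refine ⟨hcur.trans h.cur_eq, hone.trans h.one_eq, List.Subset.trans h.edges_subset hsub, hadj,
    ?_, ?_, ?_, ?_, ?_⟩
  · intro v hv
    rcases hcase with ⟨-, h1, -⟩ | ⟨-, h1, -⟩
    · rw [h1] at hv
      by_cases hvW : v ∈ W
      · exact hWcur v hvW
      · exact h.nested v (by simpa [hvW] using hv)
    · exact h.nested v (by rwa [h1] at hv)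
  · intro v B hv
    rcases hcase with ⟨-, h1, -⟩ | ⟨-, h1, -⟩
    · rw [h1] at hv
      by_cases hvW : v ∈ W
      · simp only [hvW, if_true, Option.some.injEq] at hv
        subst hv
        exact hWd v hvW
      · exact (hmono _ _).trans (h.edist_le v B (by simpa [hvW] using hv))
    · exact (hmono _ _).trans (h.edist_le v B (by rwa [h1] at hv))
  · intro B hB v x hv hcv hvx hx
    rcases List.mem_append.1 hB with hB | hB
    · obtain ⟨e, he, h1⟩ := h.covered B hB v x (hnone v hv) hcv hvx hx
      exact ⟨e, hsub he, h1⟩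
    · obtain rfl := List.mem_singleton.1 hB
      refine hWe v (mem_linked.2 ⟨(v, x), rfl, hvx, ?_, hnone v hv, ?_⟩)
      · rwa [h.cur_eq]
      · rwa [h.cur_eq]
  · intro B v hv
    rcases hcase with ⟨hMl, h1, -⟩ | ⟨-, h1, -⟩
    · by_cases hBA : ∃ w ∈ W, c'.pub.nxt w = some B
      · obtain ⟨w, hw, hwB⟩ := hBA
        have hBA : A = B := by
          rw [h1] at hwB
          simpa [hw] using hwB
        subst hBA
        have hWm : W ⊆ members c'.pub.nxt A := fun u hu => by
          rw [mem_members, h1]; simp [hu]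
        calc M ≤ l.length := hMl
          _ ≤ a * W.card := by exact_mod_cast hlW
          _ ≤ _ := by gcongr
      · have hvW : v ∉ W := fun hvW => hBA ⟨v, hvW, hv⟩
        have hsubm : members c.pub.nxt B ⊆ members c'.pub.nxt B := fun u hu => by
          rw [mem_members] at hu ⊢
          have huW : u ∉ W := fun huW => by simp [hWnone u huW] at hu
          rw [h1]; simpa [huW] using hu
        rw [h1] at hv
        calc M ≤ _ := h.large B v (by simpa [hvW] using hv)
          _ ≤ _ := by gcongr
    · rw [h1] at hv ⊢
      exact h.large B v hv
  · have hw := h.words_le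
    rw [List.filter_append, List.length_append, List.length_append]
    push_cast
    have hfil : (0 : ℝ) ≤ M * ([A].filter fun A => A ∈ centers c₀.pub.cur).length := by positivity
    rcases hcase with ⟨-, h1, h2⟩ | ⟨hMl, h1, h2⟩
    · have hcl : clustered c'.pub.nxt = clustered c.pub.nxt ∪ W := by
        ext v
        rw [mem_union, mem_clustered, mem_clustered, h1]
        by_cases hv : v ∈ W <;> simp [hv]
      have hdisj : Disjoint (clustered c.pub.nxt) W := by
        rw [Finset.disjoint_left]
        exact fun v hv hv' => mem_clustered.1 hv (hWnone v hv')
      rw [hcl, card_union_of_disjoint hdisj, h2]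
      have h3 : (l.length : ℝ) ≤ s * W.card := by
        exact_mod_cast hlW.trans (Nat.mul_le_mul_right _ has)
      push_cast
      simp only [List.length_singleton, Nat.cast_one]
      linarith
    · rw [h1, h2]
      push_cast
      simp only [List.length_singleton, Nat.cast_one]
      have h3 : (l.length : ℝ) ≤ M * ([A].filter fun A => A ∈ centers c₀.pub.cur).length := by
        -- Every vertex name is queried, but an empty cluster draws no reports; only actual centers
        -- contribute `M`.
        by_cases hA : A ∈ centers c₀.pub.cur
        · simpa [hA] using hMl.le
        · have : l = [] := by
            rw [List.eq_nil_iff_forall_not_mem]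
            intro e he
            refine hA (mem_centers.2 ⟨e.2, ?_⟩)
            rw [← h.cur_eq]
            exact (mem_replies_query E he).2.2.2.2
          simpa [this] using hfil
      linarith

/-- The invariant of a configuration whose current clusters have radius at most `d`, where all edges
at vertices outside these clusters have stretch at most `K`. -/
structure StageInvariant (E : Fin s → SimpleGraph V) (K d : ℕ) (c : Configuration V) : Prop where
  nxt_eq : ∀ v, c.pub.nxt v = none
  adj : ∀ e ∈ c.edges, (⨆ j, E j).Adj e.1 e.2
  edist_le : ∀ v A, c.pub.cur v = some A → (graphOfList c.edges).edist v A ≤ d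
  covered : ∀ u v, (⨆ j, E j).Adj u v → c.pub.cur u = none →
    (graphOfList c.edges).edist u v ≤ K

/-- The commands of one level, with threshold `M` for forming new clusters. -/
noncomputable def levelCommands (V : Type) [Fintype V] (M : ℝ) (first : Bool) :
    List (ClusterCommand V × ℝ) :=
  (univ : Finset V).toList.map (fun A => (.query A, M)) ++ [(.next first, 0)]

theorem LevelInvariant.foldl {c₀ : Configuration V} {d a : ℕ} {M : ℝ} (hM : 0 ≤ M) (has : a ≤ s)
    (hd : ∀ v A, c₀.pub.cur v = some A → (graphOfList c₀.edges).edist v A ≤ d)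
    (ha : ∀ (p : Clustering V) (A : V), p.cur = c₀.pub.cur →
      (replies E (p.upd (.query A))).length ≤ a * (linked (⨆ j, E j) p A).card)
    (L' L : List V) (c : Configuration V) (h : LevelInvariant E c₀ d a M L c) :
    LevelInvariant E c₀ d a M (L ++ L')
      ((L'.map fun A => (ClusterCommand.query A, M)).foldl (Configuration.step E) c) := by
  induction L' generalizing L c with
  | nil => simpa using h
  | cons A L' ih =>
      have := ih (L ++ [A]) _ (h.step hM has hd ha A)
      simpa using this

/-- A new cluster has at least `M / a` members, which bounds the number of new clusters; the number
of old ones bounds the cost of failures. -/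
theorem stage_level {K d a : ℕ} {c₀ : Configuration V} {M : ℝ} (h : StageInvariant E K d c₀)
    (hK : 2 * d + 1 ≤ K) (hM : 0 ≤ M) (has : a ≤ s)
    (ha : ∀ (p : Clustering V) (A : V), p.cur = c₀.pub.cur →
      (replies E (p.upd (.query A))).length ≤ a * (linked (⨆ j, E j) p A).card)
    (first : Bool) {c : Configuration V}
    (hc : c = (levelCommands V M first).foldl (Configuration.step E) c₀) :
    StageInvariant E K (d + 1) c ∧ c₀.edges ⊆ c.edges ∧
      c.pub.one = (if first then c.pub.cur else c₀.pub.one) ∧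
      (∀ v, c.pub.cur v ≠ none → c₀.pub.cur v ≠ none) ∧
      M * (centers c.pub.cur).card ≤ a * Fintype.card V ∧
      (c.words : ℝ) ≤ c₀.words + 4 * s * Fintype.card V + 2 * s +
        M * (centers c₀.pub.cur).card := by
  have h0 : LevelInvariant E c₀ d a M [] c₀ := by
    refine ⟨rfl, rfl, List.Subset.refl _, h.adj, ?_, ?_, ?_, ?_, ?_⟩
    · intro v hv; exact absurd (h.nxt_eq v) hv
    · intro v A hv; simp [h.nxt_eq v] at hv
    · simp
    · intro A v hv; simp [h.nxt_eq v] at hv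
    · simp only [List.length_nil, List.filter_nil, Nat.cast_zero, mul_zero, add_zero]
      have : (0 : ℝ) ≤ 2 * s * (clustered c₀.pub.nxt).card := by positivity
      linarith
  have h1 := LevelInvariant.foldl hM has h.edist_le ha (univ : Finset V).toList [] c₀ h0
  rw [levelCommands, List.foldl_append] at hc
  set c₁ := ((univ : Finset V).toList.map fun A => (ClusterCommand.query A, M)).foldl
    (Configuration.step E) c₀ with hc₁
  rw [List.nil_append] at h1
  have hrep : replies E (c₁.pub.upd (.next first)) = [] := by
    simp [replies, reply, upd]
  have hedges : c.edges = c₁.edges := by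
    rw [hc]; simp [Configuration.step, hrep]
  have hpub : c.pub = c₁.pub.upd (.next first) := by
    rw [hc]; simp [Configuration.step, newCluster]
  have hwords : c.words = c₁.words + 2 * s := by
    rw [hc]; simp [Configuration.step, newCluster, hrep, mul_comm]
  have hcur : c.pub.cur = c₁.pub.nxt := by rw [hpub]; rfl
  have hanti : ∀ u v, (graphOfList c.edges).edist u v ≤ (graphOfList c₀.edges).edist u v :=
    fun u v => SimpleGraph.edist_anti (graphOfList_mono (by rw [hedges]; exact h1.edges_subset))
  refine ⟨⟨fun v => by rw [hpub]; rfl, by rw [hedges]; exact h1.adj, ?_, ?_⟩,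
    by rw [hedges]; exact h1.edges_subset, ?_, ?_, ?_, ?_⟩
  · intro v A hv
    rw [hedges]; push_cast
    exact h1.edist_le v A (by rwa [hcur] at hv)
  · intro u v huv hu
    by_cases hu₀ : c₀.pub.cur u = none
    · exact (hanti u v).trans (h.covered u v huv hu₀)
    rcases hv₀ : c₀.pub.cur v with _ | A
    · rw [SimpleGraph.edist_comm]
      exact (hanti v u).trans (h.covered v u huv.symm hv₀)
    · obtain ⟨e, he, rfl, hx⟩ := h1.covered A (by simp) u v (by rwa [hcur] at hu) hu₀ huv hv₀
      rw [← hedges] at he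
      have hne : e.1 ≠ e.2 := (h1.adj e (by rwa [hedges] at he)).ne
      have h2 := edist_graphOfList_le_one he hne
      have h3 := (hanti _ _).trans (h.edist_le _ _ hx)
      have h4 := (hanti _ _).trans (h.edist_le _ _ hv₀)
      rw [SimpleGraph.edist_comm] at h4
      -- The detour leaves by the kept edge into the cluster of `v` and passes through its center
      -- `A`.
      calc _ ≤ _ := SimpleGraph.edist_triangle (v := e.2)
        _ ≤ _ := add_le_add h2 (SimpleGraph.edist_triangle (v := A))
        _ ≤ 1 + ((d : ℕ∞) + d) := by gcongr
        _ = ((2 * d + 1 : ℕ) : ℕ∞) := by push_cast; ring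
        _ ≤ K := by exact_mod_cast hK
  · rw [hcur, hpub]
    cases first
    · simpa [upd] using h1.one_eq
    · simp [upd]
  · intro v hv
    exact h1.nested v (by rwa [hcur] at hv)
  · rw [hcur]
    exact mul_card_centers_le h1.large
  · have h2 := h1.words_le
    have h3 : (((univ : Finset V).toList.filter fun A => A ∈ centers c₀.pub.cur).length : ℝ) ≤
        (centers c₀.pub.cur).card := by
      rw [← List.toFinset_card_of_nodup ((nodup_toList univ).filter _)]
      exact_mod_cast card_le_card fun A hA => by simpa using hA
    have h4 : ((clustered c₁.pub.nxt).card : ℝ) ≤ Fintype.card V := by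
      exact_mod_cast card_le_univ _
    have h5 : M * ((univ : Finset V).toList.filter fun A => A ∈ centers c₀.pub.cur).length ≤
        M * (centers c₀.pub.cur).card := mul_le_mul_of_nonneg_left h3 hM
    have h6 : 2 * (s : ℝ) * (clustered c₁.pub.nxt).card ≤ 2 * s * Fintype.card V := by gcongr
    rw [length_toList, card_univ] at h2
    rw [hwords]
    push_cast
    linarith

end Level

/-! ### All levels, the final step and the stretch -/

section Spanner

open Clustering Finset

/-- A subgraph in which the edges have stretch at most `K` is a spanner. -/
theorem isMulSpanner_of_adj {V : Type} {K : ℕ} {G H : SimpleGraph V} (hK : 0 < K)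
    (hHG : H ≤ G) (h : ∀ u v, G.Adj u v → H.edist u v ≤ K) : IsMulSpanner K G H := by
  refine ⟨hHG, fun u v => ?_⟩
  have hwalk : ∀ {u v : V} (p : G.Walk u v), H.edist u v ≤ K * (p.length : ℕ∞) := by
    intro u v p
    induction p with
    | nil => simp
    | cons huv p ih =>
        calc _ ≤ _ := SimpleGraph.edist_triangle
          _ ≤ (K : ℕ∞) + K * (p.length : ℕ∞) := add_le_add (h _ _ huv) ih
          _ = _ := by rw [SimpleGraph.Walk.length_cons]; push_cast; ring
  by_cases huv : G.Reachable u v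
  · obtain ⟨p, hp⟩ := huv.exists_walk_length_eq_edist
    rw [← hp]
    exact hwalk p
  · have hne : u ≠ v := by rintro rfl; exact huv (SimpleGraph.Reachable.refl _)
    have htop : G.edist u v = ⊤ := by
      by_contra hcon
      exact huv (SimpleGraph.reachable_of_edist_ne_top hcon)
    rw [htop]
    rw [ENat.mul_top (by exact_mod_cast hK.ne')]
    exact le_top

variable {V : Type} [Fintype V] [DecidableEq V]

/-- The commands of the levels `0, …, t` of the clustering. -/
noncomputable def levelsCommands (V : Type) [Fintype V] (s : ℕ) (X : ℝ) :
    ℕ → List (ClusterCommand V × ℝ)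
  | 0 => levelCommands V X true
  -- At most `s ^ t * n / X ^ (t + 1)` clusters enter this level, so the threshold makes failed
  -- queries cost at most `n * X`.
  | t + 1 => levelsCommands V s X t ++ levelCommands V (X ^ (t + 2) / s ^ t) false

/-- The initial public state, in which all vertices are singleton clusters. -/
def Clustering.singletons (V : Type) : Clustering V := ⟨some, some, fun _ => none, .final⟩

variable [Nonempty V] {s : ℕ} {E : Fin s → SimpleGraph V}

theorem stage_levels (hE : WithoutDuplication E) (hs : 1 ≤ s) {X : ℝ} (hX : 0 < X) {K : ℕ} (t : ℕ)
    (hK : 2 * t + 1 ≤ K) {c : Configuration V}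
    (hc : c = (levelsCommands V s X t).foldl (Configuration.step E)
      ⟨Clustering.singletons V, [], 0⟩) :
    StageInvariant E K (t + 1) c ∧
      (∀ v A, c.pub.one v = some A → (graphOfList c.edges).edist v A ≤ 1) ∧
      (∀ v, c.pub.cur v ≠ none → c.pub.one v ≠ none) ∧
      X * (centers c.pub.one).card ≤ Fintype.card V ∧
      X ^ (t + 1) * (centers c.pub.cur).card ≤ s ^ t * Fintype.card V ∧
      (c.words : ℝ) ≤ (t + 1) * (Fintype.card V * X + 4 * s * Fintype.card V + 2 * s) := by
  have hs' : (0 : ℝ) < s := by exact_mod_cast hs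
  induction t generalizing c with
  | zero =>
      have h0 : StageInvariant E K 0 (⟨Clustering.singletons V, [], 0⟩ : Configuration V) := by
        refine ⟨fun v => rfl, by simp, ?_, ?_⟩
        · intro v A hv
          obtain rfl : v = A := Option.some.inj hv
          simp
        · intro u v _ hu
          cases hu
      -- The absence of duplication enters only here: it gives `a = 1`, so the first level loses no
      -- factor `s`.
      obtain ⟨h1, -, h2, -, h3, h4⟩ := stage_level h0 (by omega) hX.le hs
        (fun p A hp => length_replies_query_singletons E hE p hp A) true hc
      rw [if_pos rfl] at h2
      have h5 : X * (centers c.pub.cur).card ≤ Fintype.card V := by simpa using h3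
      have h6 : X * (centers (some : V → Option V)).card ≤ X * Fintype.card V := by
        gcongr; exact card_le_univ _
      refine ⟨h1, ?_, ?_, ?_, by simpa using h5, ?_⟩
      · intro v A hv
        rw [h2] at hv
        simpa using h1.edist_le v A hv
      · intro v hv
        rwa [h2]
      · rwa [h2]
      · simp only [Clustering.singletons, Nat.cast_zero] at h4 ⊢
        linarith
  | succ t ih =>
      rw [levelsCommands, List.foldl_append] at hc
      obtain ⟨g1, g2, g3, g4, g5, g6⟩ := ih (by omega) rfl
      set c₀ := (levelsCommands V s X t).foldl (Configuration.step E)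
        ⟨Clustering.singletons V, [], 0⟩
      have hM : 0 < X ^ (t + 2) / (s : ℝ) ^ t := by positivity
      obtain ⟨h1, h2, h3, h4, h5, h6⟩ := stage_level g1 (by omega) hM.le le_rfl
        (fun p A _ => length_replies_query_le E p A) false hc
      rw [if_neg (by simp)] at h3
      refine ⟨h1, ?_, ?_, by rwa [h3], ?_, ?_⟩
      · intro v A hv
        rw [h3] at hv
        exact (SimpleGraph.edist_anti (graphOfList_mono h2)).trans (g2 v A hv)
      · intro v hv
        rw [h3]
        exact g3 v (h4 v hv)
      · rw [div_mul_eq_mul_div, div_le_iff₀ (by positivity)] at h5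
        calc _ ≤ _ := h5
          _ = _ := by ring
      · have h7 : X ^ (t + 2) / (s : ℝ) ^ t * (centers c₀.pub.cur).card ≤ Fintype.card V * X := by
          rw [div_mul_eq_mul_div, div_le_iff₀ (by positivity)]
          calc X ^ (t + 2) * ((centers c₀.pub.cur).card : ℝ)
              = X * (X ^ (t + 1) * (centers c₀.pub.cur).card) := by ring
            _ ≤ X * (s ^ t * Fintype.card V) := by gcongr
            _ = _ := by ring
        push_cast
        linarith

/-- The final step covers all edges between the current clusters. -/
theorem stage_final {K d : ℕ} {c₀ : Configuration V} (h : StageInvariant E K d c₀)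
    (hK : 2 * d + 3 ≤ K)
    (hone : ∀ v A, c₀.pub.one v = some A → (graphOfList c₀.edges).edist v A ≤ 1)
    (hcur : ∀ v, c₀.pub.cur v ≠ none → c₀.pub.one v ≠ none) {c : Configuration V}
    (hc : c = c₀.step E (.final, 0)) :
    IsMulSpanner K (⨆ j, E j) (graphOfList c.edges) ∧
      c.words ≤ c₀.words + 2 * s +
        s * ((centers c₀.pub.one).card * (centers c₀.pub.cur).card) := by
  have hrep : ∀ j, reply (E j) (c₀.pub.upd .final) = representatives (IsBridge (E j) c₀.pub) :=
    fun j => rfl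
  have hedges : c.edges = c₀.edges ++ replies E (c₀.pub.upd .final) := by rw [hc]; rfl
  have hwords : c.words = c₀.words + (s * 2 + (replies E (c₀.pub.upd .final)).length) := by
    rw [hc]; rfl
  have hadj : ∀ e ∈ c.edges, (⨆ j, E j).Adj e.1 e.2 := fun e he => by
    rw [hedges, List.mem_append] at he
    refine he.elim (h.adj e) fun he => ?_
    obtain ⟨j, hj⟩ := mem_replies.1 he
    rw [hrep] at hj
    obtain ⟨q, hq⟩ := exists_of_mem_representatives hj
    exact SimpleGraph.iSup_adj.2 ⟨j, hq.1⟩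
  have hanti : ∀ u v, (graphOfList c.edges).edist u v ≤ (graphOfList c₀.edges).edist u v :=
    fun u v => SimpleGraph.edist_anti
      (graphOfList_mono (by rw [hedges]; exact List.subset_append_left _ _))
  refine ⟨isMulSpanner_of_adj (by omega) (graphOfList_le hadj) fun u v huv => ?_, ?_⟩
  · by_cases hu : c₀.pub.cur u = none
    · exact (hanti u v).trans (h.covered u v huv hu)
    rcases hv : c₀.pub.cur v with _ | B
    · rw [SimpleGraph.edist_comm]
      exact (hanti v u).trans (h.covered v u huv.symm hv)
    obtain ⟨A, hA⟩ := Option.ne_none_iff_exists'.1 (hcur u hu)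
    obtain ⟨j, hj⟩ := SimpleGraph.iSup_adj.1 huv
    obtain ⟨e, he, -, he1, he2⟩ := exists_mem_representatives
      (r := IsBridge (E j) c₀.pub) (i := (A, B)) (e := (u, v)) ⟨hj, hA, hv⟩
    have hec : e ∈ c.edges := by
      rw [hedges]
      exact List.mem_append_right _ (mem_replies.2 ⟨j, by rwa [hrep]⟩)
    have h1 := (hanti _ _).trans (hone _ _ hA)
    have h2 := (hanti _ _).trans (hone _ _ he1)
    have h3 := edist_graphOfList_le_one hec (hadj e hec).ne
    have h4 := (hanti _ _).trans (h.edist_le _ _ he2)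
    have h5 := (hanti _ _).trans (h.edist_le _ _ hv)
    rw [SimpleGraph.edist_comm] at h2 h5
    -- The path runs from `u` through the center `A` to `e.1`, along `e`, and through the center `B`
    -- to `v`.
    calc _ ≤ _ := SimpleGraph.edist_triangle (v := A)
      _ ≤ _ := add_le_add h1 (SimpleGraph.edist_triangle (v := e.1))
      _ ≤ _ := add_le_add le_rfl (add_le_add h2 (SimpleGraph.edist_triangle (v := e.2)))
      _ ≤ _ := add_le_add le_rfl (add_le_add le_rfl
          (add_le_add h3 (SimpleGraph.edist_triangle (v := B))))
      _ ≤ 1 + (1 + (1 + ((d : ℕ∞) + d))) := by gcongr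
      _ = ((2 * d + 3 : ℕ) : ℕ∞) := by push_cast; ring
      _ ≤ K := by exact_mod_cast hK
  · rw [hwords, length_replies]
    have h1 : ∀ j ∈ (univ : Finset (Fin s)), (reply (E j) (c₀.pub.upd .final)).length ≤
        (centers c₀.pub.one).card * (centers c₀.pub.cur).card := fun j _ => by
      rw [hrep, length_representatives, ← card_product]
      refine card_le_card fun q hq => ?_
      simp only [mem_filter, mem_univ, true_and] at hq
      obtain ⟨e, -, he1, he2⟩ := hq
      exact mem_product.2 ⟨mem_centers.2 ⟨_, he1⟩, mem_centers.2 ⟨_, he2⟩⟩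
    have h2 := Finset.sum_le_card_nsmul _ _ _ h1
    rw [card_univ, Fintype.card_fin, smul_eq_mul] at h2
    omega

/-- The spanner and the number of words of the whole clustering protocol. -/
theorem clustering_spanner (hE : WithoutDuplication E) (hs : 1 ≤ s) {X : ℝ} (hX : 0 < X) (t : ℕ)
    (hXt : X ^ (t + 3) = s ^ (t + 1) * Fintype.card V) {c : Configuration V}
    (hc : c = (levelsCommands V s X t ++ [(ClusterCommand.final, 0)]).foldl (Configuration.step E)
      ⟨Clustering.singletons V, [], 0⟩) :
    IsMulSpanner (2 * t + 5) (⨆ j, E j) (graphOfList c.edges) ∧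
      (c.words : ℝ) ≤ 6 * (t + 3) * (Fintype.card V * X + s * Fintype.card V) := by
  obtain ⟨h1, h2, h3, h4, h5, h6⟩ := stage_levels hE hs hX (K := 2 * t + 5) t (by omega) rfl
  rw [List.foldl_append] at hc
  set c₀ := (levelsCommands V s X t).foldl (Configuration.step E)
    ⟨Clustering.singletons V, [], 0⟩
  obtain ⟨g1, g2⟩ := stage_final h1 (by omega) h2 h3 hc
  refine ⟨g1, ?_⟩
  have hn : (1 : ℝ) ≤ Fintype.card V := by exact_mod_cast Fintype.card_pos
  set n : ℝ := (Fintype.card V : ℝ)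
  set a : ℝ := ((centers c₀.pub.one).card : ℝ)
  set b : ℝ := ((centers c₀.pub.cur).card : ℝ)
  -- The equation for `X` balances the final step against the levels: the two cluster counts
  -- multiply to at most `s ^ t * n ^ 2 / X ^ (t + 2)`.
  have h7 : s * (a * b) ≤ n * X := by
    have h8 : X ^ (t + 2) * (s * (a * b)) ≤ X ^ (t + 2) * (n * X) := by
      calc X ^ (t + 2) * (s * (a * b)) = s * ((X * a) * (X ^ (t + 1) * b)) := by ring
        _ ≤ s * (n * (s ^ t * n)) := by
          gcongr
        _ = n * (s ^ (t + 1) * n) := by ring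
        _ = X ^ (t + 2) * (n * X) := by rw [← hXt]; ring
    exact le_of_mul_le_mul_left h8 (by positivity)
  have g3 : (c.words : ℝ) ≤ c₀.words + 2 * s + s * (a * b) := by
    simpa [a, b] using (Nat.cast_le (α := ℝ)).2 g2
  have h9 : (s : ℝ) ≤ s * n := le_mul_of_one_le_right (Nat.cast_nonneg s) hn
  have h10 : (0 : ℝ) ≤ t * (s * n - s) := mul_nonneg (Nat.cast_nonneg t) (by linarith)
  have h11 : (0 : ℝ) ≤ n * X := by positivity
  have h12 : (0 : ℝ) ≤ t * (n * X) := by positivity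
  nlinarith

end Spanner

/-! ### Word length and the final bound -/

/-- Commands as elements of a sum type. -/
def ClusterCommand.toSum {V : Type} : ClusterCommand V → (V × V) ⊕ V ⊕ Option Bool
  | .assign v A => .inl (v, A)
  | .query A => .inr (.inl A)
  | .next first => .inr (.inr (some first))
  | .final => .inr (.inr none)

theorem ClusterCommand.toSum_injective {V : Type} :
    Function.Injective (ClusterCommand.toSum (V := V)) := by
  rintro (_ | _ | _ | _) (_ | _ | _ | _) h <;> simp_all [ClusterCommand.toSum]

/-- The clustering protocol can be written in words of a given length when the commands and the
reported edges fit into these words. -/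
theorem exists_clusteringCode {n L : ℕ} (hn : 2 ≤ n) (hL : 4 * n ^ 2 ≤ 2 ^ L) :
    ∃ P : RoundCode (Clustering (Fin n)) (ClusterCommand (Fin n)) (Fin n × Fin n)
        (SimpleGraph (Fin n)),
      have : Nonempty (Fin n) := ⟨⟨0, by omega⟩⟩
      P.width = L ∧ P.upd = Clustering.upd ∧ P.reply = Clustering.reply ∧
        P.start = Clustering.singletons (Fin n) := by
  have : Nonempty (Fin n) := ⟨⟨0, by omega⟩⟩
  have : Nonempty (ClusterCommand (Fin n)) := ⟨.final⟩
  have hL0 : 0 < L := by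
    rcases Nat.eq_zero_or_pos L with rfl | h
    · nlinarith
    · exact h
  obtain ⟨encB, decB, hB1, hB2⟩ := exists_word_code (m := L)
    -- There are `n ^ 2 + n + 3` commands, at most `4 * n ^ 2` since `n ≥ 2`.
    (ClusterCommand.toSum_injective (V := Fin n)) (by simp; nlinarith)
  obtain ⟨encR, decR, hR1, hR2⟩ := exists_word_code (m := L)
    (Function.injective_id (α := Option (Fin n × Fin n))) (by simp; nlinarith)
  exact ⟨⟨L, hL0, encB, decB, hB1, hB2, encR, decR, hR1, hR2, Clustering.singletons (Fin n),
    Clustering.upd, Clustering.reply, _, Clustering.length_reply_le⟩, rfl, rfl, rfl, rfl⟩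

/-- The clustering protocol: the deterministic cost in terms of the word length `L`. -/
theorem spannerCost_le {n s L t : ℕ} (hn : 2 ≤ n) (hs : 1 ≤ s) (hL : 4 * n ^ 2 ≤ 2 ^ L) {X : ℝ}
    (hX : 0 < X) (hXt : X ^ (t + 3) = s ^ (t + 1) * n) {δ : ℝ} (hδ : 0 ≤ δ) {B : ℝ}
    (hB : L * (6 * (t + 3) * (n * X + s * n)) ≤ B) :
    SpannerCostWithoutDuplicationLE n s (2 * t + 5) δ B := by
  have : Nonempty (Fin n) := ⟨⟨0, by omega⟩⟩
  obtain ⟨P, hwidth, hupd, hreply, hstart⟩ := exists_clusteringCode hn hL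
  refine ⟨P.toProtocol (clusterStrategy s
    (levelsCommands (Fin n) s X t ++ [(ClusterCommand.final, 0)]) [] []), fun E hE => ?_⟩
  obtain ⟨h1, h2⟩ := roundRun_clusterStrategy P hupd hreply E
    (levelsCommands (Fin n) s X t ++ [(ClusterCommand.final, 0)]) [] [] P.start 0
  obtain ⟨h3, h4⟩ := clustering_spanner hE hs hX t (by simpa using hXt) rfl
  rw [hstart] at h1 h2
  constructor
  · intro ω
    rw [CoordProtocol.bits, P.toProtocol_exec, hwidth, hstart]
    refine le_trans ?_ hB
    push_cast
    refine mul_le_mul_of_nonneg_left ?_ (Nat.cast_nonneg L)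
    rw [Fintype.card_fin] at h4
    refine le_trans ?_ h4
    exact_mod_cast by simpa using h2
  · rw [CoordProtocol.prob_eq_one]
    · linarith
    · intro ω
      rw [CoordProtocol.result, P.toProtocol_exec, hstart, h1]
      exact h3

theorem mainTheorem5 :
    ∃ a : ℕ, ∀ c : ℕ, ∃ C : ℝ, 0 < C ∧
      ∀ k n s : ℕ, 3 ≤ k → 2 ≤ n → 1 ≤ s →
        SpannerCostWithoutDuplicationLE n s (2 * k - 1) (1 / (n : ℝ) ^ c)
          (C * Real.logb 2 (n : ℝ) ^ a *
            ((k : ℝ) * (s : ℝ) ^ (1 - 2 / (k : ℝ)) * (n : ℝ) ^ (1 + 1 / (k : ℝ))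
              + (s : ℝ) * (n : ℝ) * (k : ℝ))) := by
  -- One logarithm comes from the word length, at most `6 * Real.logb 2 n`; the other factor `6` is
  -- from the word count.
  refine ⟨1, fun c => ⟨36, by norm_num, fun k n s hk hn hs => ?_⟩⟩
  obtain ⟨t, rfl⟩ : ∃ t, k = t + 3 := ⟨k - 3, by omega⟩
  have hn0 : (0 : ℝ) < n := by positivity
  have hs0 : (0 : ℝ) < s := by positivity
  have hk0 : (0 : ℝ) < ((t + 3 : ℕ) : ℝ) := by positivity
  set κ : ℝ := ((t + 3 : ℕ) : ℝ) with hκ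
  set X : ℝ := (s : ℝ) ^ (1 - 2 / κ) * (n : ℝ) ^ (1 / κ) with hXdef
  have hX : 0 < X := by positivity
  have hXt : X ^ (t + 3) = s ^ (t + 1) * n := by
    rw [hXdef, mul_pow, ← Real.rpow_natCast, ← Real.rpow_mul hs0.le, ← Real.rpow_natCast,
      ← Real.rpow_mul hn0.le, ← hκ, one_div, inv_mul_cancel₀ hk0.ne', Real.rpow_one]
    have : (1 - 2 / κ) * κ = ((t + 1 : ℕ) : ℝ) := by
      rw [sub_mul, div_mul_cancel₀ _ hk0.ne', hκ]; push_cast; ring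
    rw [this, Real.rpow_natCast]
  have hnX : (n : ℝ) * X = (s : ℝ) ^ (1 - 2 / κ) * (n : ℝ) ^ (1 + 1 / κ) := by
    rw [Real.rpow_add hn0, Real.rpow_one]; ring
  have hL : 4 * n ^ 2 ≤ 2 ^ (2 * Nat.log 2 n + 4) := by
    have h := Nat.lt_pow_succ_log_self one_lt_two n
    calc 4 * n ^ 2 ≤ 4 * (2 ^ (Nat.log 2 n + 1)) ^ 2 := by gcongr
      _ = _ := by ring
  have hlog : ((2 * Nat.log 2 n + 4 : ℕ) : ℝ) ≤ 6 * Real.logb 2 n := by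
    have h1 : (Nat.log 2 n : ℝ) ≤ Real.logb 2 n := by exact_mod_cast Real.natLog_le_logb n 2
    have h2 : 1 ≤ Real.logb 2 n := by
      rw [Real.le_logb_iff_rpow_le one_lt_two hn0, Real.rpow_one]
      exact_mod_cast hn
    push_cast
    linarith
  rw [show 2 * (t + 3) - 1 = 2 * t + 5 by omega]
  refine spannerCost_le hn hs hL hX hXt (by positivity) ?_
  calc _ ≤ 6 * Real.logb 2 n * (6 * (t + 3) * (n * X + s * n)) := by gcongr
    _ = _ := by
      rw [mul_assoc κ, ← hnX, hκ]; push_cast; ring
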